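/- Let $\mathrm{SOL}$ be $\mathbb{R}^3$ with coordinates $(x,y,z)$ and the Riemannian metric $ds^2=e^{-2z}dx^2+e^{2z}dy^2+dz^2$, and let $d$ be its Riemannian distance. Let $\gamma=(x,y,z):\mathbb{R}\to\mathrm{SOL}$ be a unit-speed geodesic that is generic, i.e. none of the coordinate functions $x(t)$, $y(t)$, $z(t)$ is constant (so $\gamma$ is neither vertical, nor horizontal, nor contained in a vertical plane $x=\mathrm{const}$ or $y=\mathrm{const}$). Let $$k=\sqrt{\frac{\|\dot\gamma\|^2-2|\dot x\dot y|}{\|\dot\gamma\|^2+2|\dot x\dot y|}}$$ be its modulus (the right-hand side does not depend on $t$, and $0<k<1$), and put $$T(k)=\sqrt{8(1+k^2)}\,K(k),\qquad K(k)=\int_0^{\pi/2}\frac{d\theta}{\sqrt{1-k^2\sin^2\theta}} .$$ Then $T(k)$ is the least positive period of the function $t\mapsto z(t)$, and for all $t_1,t_2\in\mathbb{R}$ with $t_2-t_1>T(k)$ one has $$d\bigl(\gamma(t_1),\gamma(t_2)\bigr)<t_2-t_1 .$$ In other words, generic geodesic segments longer than $T(k)$ are not minimizing. -/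

import Mathlib

open scoped Manifold ContDiff Bundle ENNReal

noncomputable section

/-- The underlying manifold of `SOL`: the space `ℝ³` with coordinates `(x, y, z)`. It is a type
synonym, so that the Euclidean metric of `ℝ³` plays no role. -/
def SOL : Type := EuclideanSpace ℝ (Fin 3)

namespace SOL

instance : TopologicalSpace SOL := inferInstanceAs (TopologicalSpace (EuclideanSpace ℝ (Fin 3)))

instance : ChartedSpace (EuclideanSpace ℝ (Fin 3)) SOL :=
  chartedSpaceSelf (EuclideanSpace ℝ (Fin 3))

instance : IsManifold 𝓘(ℝ, EuclideanSpace ℝ (Fin 3)) ∞ SOL :=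
  instIsManifoldModelSpace (I := 𝓘(ℝ, EuclideanSpace ℝ (Fin 3))) (n := ∞)

/-- The coordinates `(x, y, z)` of a point, indexed by `0, 1, 2`. -/
def coord (p : SOL) : Fin 3 → ℝ := fun i => WithLp.ofLp (show EuclideanSpace ℝ (Fin 3) from p) i

/-- The quadratic form `ds² = e^{-2z} dx² + e^{2z} dy² + dz²` (polarized) in the coordinates
`(x, y, z)`, at the point with coordinates `q`. -/
def metricForm (q v w : Fin 3 → ℝ) : ℝ :=
  Real.exp (-2 * q 2) * (v 0 * w 0) + Real.exp (2 * q 2) * (v 1 * w 1) + v 2 * w 2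

/-- The form `metricForm q` as a continuous bilinear form on `ℝ³`. -/
def metricCLM (q : Fin 3 → ℝ) :
    EuclideanSpace ℝ (Fin 3) →L[ℝ] EuclideanSpace ℝ (Fin 3) →L[ℝ] ℝ :=
  Real.exp (-2 * q 2) •
      (EuclideanSpace.proj (𝕜 := ℝ) (0 : Fin 3)).smulRight (EuclideanSpace.proj (𝕜 := ℝ) (0 : Fin 3))
    + Real.exp (2 * q 2) •
      (EuclideanSpace.proj (𝕜 := ℝ) (1 : Fin 3)).smulRight (EuclideanSpace.proj (𝕜 := ℝ) (1 : Fin 3))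
    + (EuclideanSpace.proj (𝕜 := ℝ) (2 : Fin 3)).smulRight (EuclideanSpace.proj (𝕜 := ℝ) (2 : Fin 3))

theorem metricCLM_apply (q : Fin 3 → ℝ) (v w : EuclideanSpace ℝ (Fin 3)) :
    metricCLM q v w = metricForm q (fun i => v i) (fun i => w i) := by
  simp [metricCLM, metricForm]

theorem metricCLM_symm (q : Fin 3 → ℝ) (v w : EuclideanSpace ℝ (Fin 3)) :
    metricCLM q v w = metricCLM q w v := by
  simp only [metricCLM_apply, metricForm]; ring

theorem metricCLM_pos (q : Fin 3 → ℝ) (v : EuclideanSpace ℝ (Fin 3)) (hv : v ≠ 0) :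
    0 < metricCLM q v v := by
  rw [metricCLM_apply, metricForm]
  have h1 := Real.exp_pos (-2 * q 2)
  have h2 := Real.exp_pos (2 * q 2)
  have a0 := mul_nonneg h1.le (mul_self_nonneg (v 0))
  have a1 := mul_nonneg h2.le (mul_self_nonneg (v 1))
  have a2 := mul_self_nonneg (v 2)
  by_contra hle
  apply hv
  have e0 : v 0 = 0 := by
    have : Real.exp (-2 * q 2) * (v 0 * v 0) = 0 := by linarith
    simpa [h1.ne'] using this
  have e1 : v 1 = 0 := by
    have : Real.exp (2 * q 2) * (v 1 * v 1) = 0 := by linarith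
    simpa [h2.ne'] using this
  have e2 : v 2 = 0 := by
    have : v 2 * v 2 = 0 := by linarith
    simpa using this
  ext i
  fin_cases i <;> simp [e0, e1, e2]

theorem metricCLM_isVonNBounded (q : Fin 3 → ℝ) :
    Bornology.IsVonNBounded ℝ {v : EuclideanSpace ℝ (Fin 3) | metricCLM q v v < 1} := by
  rw [NormedSpace.isVonNBounded_iff, isBounded_iff_forall_norm_le]
  refine ⟨Real.sqrt (Real.exp (2 * q 2) + Real.exp (-2 * q 2) + 1), fun v hv => ?_⟩
  have hv' : metricCLM q v v < 1 := hv
  rw [metricCLM_apply, metricForm] at hv'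
  rw [EuclideanSpace.norm_eq]
  apply Real.sqrt_le_sqrt
  have h1 := Real.exp_pos (-2 * q 2)
  have h2 := Real.exp_pos (2 * q 2)
  have h12 : Real.exp (-2 * q 2) * Real.exp (2 * q 2) = 1 := by
    rw [← Real.exp_add]; simp
  have a0 := mul_nonneg h1.le (mul_self_nonneg (v 0))
  have a1 := mul_nonneg h2.le (mul_self_nonneg (v 1))
  have a2 := mul_self_nonneg (v 2)
  simp only [Fin.sum_univ_three, Real.norm_eq_abs, sq_abs]
  have b0 : v 0 ^ 2 ≤ Real.exp (2 * q 2) := by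
    have : Real.exp (2 * q 2) * (Real.exp (-2 * q 2) * (v 0 * v 0)) ≤ Real.exp (2 * q 2) * 1 :=
      mul_le_mul_of_nonneg_left (by linarith) h2.le
    nlinarith
  have b1 : v 1 ^ 2 ≤ Real.exp (-2 * q 2) := by
    have : Real.exp (-2 * q 2) * (Real.exp (2 * q 2) * (v 1 * v 1)) ≤ Real.exp (-2 * q 2) * 1 :=
      mul_le_mul_of_nonneg_left (by linarith) h1.le
    nlinarith
  nlinarith

theorem contDiff_smul_fixed {F G : Type*} [NormedAddCommGroup F] [NormedSpace ℝ F]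
    [NormedAddCommGroup G] [NormedSpace ℝ G] {f : F → ℝ} (hf : ContDiff ℝ ∞ f) (B : G) :
    ContDiff ℝ ∞ (fun q => f q • B) :=
  hf.smul contDiff_const

theorem contDiff_metricCLM :
    ContDiff ℝ ∞ (fun q : EuclideanSpace ℝ (Fin 3) => metricCLM (fun i => q i)) := by
  have h2 : ContDiff ℝ ∞ (fun q : EuclideanSpace ℝ (Fin 3) => q 2) := by fun_prop
  unfold metricCLM
  refine ContDiff.add (ContDiff.add ?_ ?_) contDiff_const
  · exact contDiff_smul_fixed (Real.contDiff_exp.comp (contDiff_const.mul h2)) _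
  · exact contDiff_smul_fixed (Real.contDiff_exp.comp (contDiff_const.mul h2)) _

/-- A smooth family of bilinear forms on a vector space is a smooth section of the corresponding
bundle over the vector space. -/
theorem contMDiff_section_of_contDiff {F : Type*} [NormedAddCommGroup F] [NormedSpace ℝ F]
    (g : (p : F) → TangentSpace 𝓘(ℝ, F) p →L[ℝ] TangentSpace 𝓘(ℝ, F) p →L[ℝ] ℝ)
    (hg : ContDiff ℝ ∞ (fun p => (show F →L[ℝ] F →L[ℝ] ℝ from g p))) :
    ContMDiff 𝓘(ℝ, F) (𝓘(ℝ, F).prod 𝓘(ℝ, F →L[ℝ] F →L[ℝ] ℝ)) ∞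
      (fun p : F => Bundle.TotalSpace.mk' (F →L[ℝ] F →L[ℝ] ℝ)
        (E := fun p : F => TangentSpace 𝓘(ℝ, F) p →L[ℝ] TangentSpace 𝓘(ℝ, F) p →L[ℝ] ℝ)
        p (g p)) := by
  intro p
  rw [Bundle.contMDiffAt_section]
  convert! (contMDiff_iff_contDiff.2 hg) p
  ext v w
  rw [hom_trivializationAt_apply]
  rename_i y
  have hy : y ∈ (trivializationAt F (TangentSpace 𝓘(ℝ, F)) p).baseSet := by
    simp [TangentBundle.trivializationAt_baseSet, chartAt_self_eq]
  have hs : ∀ u : F, (trivializationAt F (TangentSpace 𝓘(ℝ, F)) p).symm y u = u := fun u => by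
    have h := DFunLike.congr_fun (TangentBundle.symmL_model_space (𝕜 := ℝ) (F := F) p y) u
    rwa [Bundle.Trivialization.symmL_apply _ hy] at h
  refine (inCoordinates_apply_eq₂ (F₃ := ℝ) (E₃ := Bundle.Trivial F ℝ) hy hy
    (by simp)).trans ?_
  rw [hs, hs]
  simp
  rfl

/-- The metric on the tangent space of `SOL` at `p`. -/
def metricAt (p : SOL) : TangentSpace 𝓘(ℝ, EuclideanSpace ℝ (Fin 3)) p →L[ℝ]
    TangentSpace 𝓘(ℝ, EuclideanSpace ℝ (Fin 3)) p →L[ℝ] ℝ :=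
  metricCLM p.coord

theorem contMDiff_metricAt :
    ContMDiff 𝓘(ℝ, EuclideanSpace ℝ (Fin 3)) (𝓘(ℝ, EuclideanSpace ℝ (Fin 3)).prod
      𝓘(ℝ, EuclideanSpace ℝ (Fin 3) →L[ℝ] EuclideanSpace ℝ (Fin 3) →L[ℝ] ℝ)) ∞
      (fun p : SOL => Bundle.TotalSpace.mk'
        (EuclideanSpace ℝ (Fin 3) →L[ℝ] EuclideanSpace ℝ (Fin 3) →L[ℝ] ℝ) p (metricAt p)) := by
  exact contMDiff_section_of_contDiff (F := EuclideanSpace ℝ (Fin 3)) metricAt contDiff_metricCLM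

/-- The Riemannian metric `e^{-2z} dx² + e^{2z} dy² + dz²` on `SOL`. -/
def metric : Bundle.ContMDiffRiemannianMetric 𝓘(ℝ, EuclideanSpace ℝ (Fin 3)) ∞
    (EuclideanSpace ℝ (Fin 3))
    (fun p : SOL => TangentSpace 𝓘(ℝ, EuclideanSpace ℝ (Fin 3)) p) where
  inner := metricAt
  symm _ v w := metricCLM_symm _ v w
  pos _ v hv := metricCLM_pos _ v hv
  isVonNBounded _ := metricCLM_isVonNBounded _
  contMDiff := contMDiff_metricAt

instance : Bundle.RiemannianBundle
    (fun p : SOL => TangentSpace 𝓘(ℝ, EuclideanSpace ℝ (Fin 3)) p) :=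
  ⟨metric.toRiemannianMetric⟩

/-- The Riemannian distance of `SOL`, the infimum of the lengths of `C¹` paths. -/
def dist (p q : SOL) : ℝ≥0∞ :=
  Manifold.riemannianEDist 𝓘(ℝ, EuclideanSpace ℝ (Fin 3)) p q

/-- The coordinates `(ẋ, ẏ, ż)` of the velocity of a curve at time `t`. -/
def velocity (γ : ℝ → SOL) (t : ℝ) : Fin 3 → ℝ := fun i => deriv (fun s => (γ s).coord i) t

/-- The squared Riemannian norm `‖γ̇(t)‖²` of the velocity. -/
def speedSq (γ : ℝ → SOL) (t : ℝ) : ℝ :=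
  metricForm (γ t).coord (velocity γ t) (velocity γ t)

/-- The Lagrangian `½ ‖v‖²` in coordinates. -/
def lagrangian (q v : Fin 3 → ℝ) : ℝ := 1 / 2 * metricForm q v v

/-- The partial derivative `∂L/∂qᵢ`. -/
def lagrangianDq (i : Fin 3) (q v : Fin 3 → ℝ) : ℝ :=
  deriv (fun s => lagrangian (Function.update q i s) v) (q i)

/-- The partial derivative `∂L/∂vᵢ`. -/
def lagrangianDv (i : Fin 3) (q v : Fin 3 → ℝ) : ℝ :=
  deriv (fun s => lagrangian q (Function.update v i s)) (v i)

/-- A (complete) geodesic: a smooth curve that satisfies the Euler-Lagrange equations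
`d/dt (∂L/∂vᵢ) = ∂L/∂qᵢ` of the action with Lagrangian `L = ½ ‖γ̇‖²`. -/
structure IsGeodesic (γ : ℝ → SOL) : Prop where
  smooth : ContMDiff 𝓘(ℝ, ℝ) 𝓘(ℝ, EuclideanSpace ℝ (Fin 3)) ∞ γ
  eulerLagrange : ∀ (i : Fin 3) (t : ℝ),
    HasDerivAt (fun s => lagrangianDv i (γ s).coord (velocity γ s))
      (lagrangianDq i (γ t).coord (velocity γ t)) t

/-- The `i`-th coordinate is constant along the curve. -/
def CoordConst (γ : ℝ → SOL) (i : Fin 3) : Prop := ∀ s t : ℝ, (γ s).coord i = (γ t).coord i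

/-- Vertical curves: `x` and `y` are constant. -/
def IsVertical (γ : ℝ → SOL) : Prop := CoordConst γ 0 ∧ CoordConst γ 1

/-- Horizontal curves: `z` is constant. -/
def IsHorizontal (γ : ℝ → SOL) : Prop := CoordConst γ 2

/-- Hyperbolic curves: contained in a vertical plane `x = const` or `y = const`. -/
def IsHyperbolic (γ : ℝ → SOL) : Prop := CoordConst γ 0 ∨ CoordConst γ 1

/-- A generic geodesic: neither vertical, nor horizontal, nor hyperbolic. -/
structure IsGenericGeodesic (γ : ℝ → SOL) : Prop where
  isGeodesic : IsGeodesic γ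
  not_vertical : ¬ IsVertical γ
  not_horizontal : ¬ IsHorizontal γ
  not_hyperbolic : ¬ IsHyperbolic γ

/-- The modulus of a geodesic, computed at time `t`. -/
def modulus (γ : ℝ → SOL) (t : ℝ) : ℝ :=
  Real.sqrt ((speedSq γ t - 2 * |velocity γ t 0 * velocity γ t 1|) /
    (speedSq γ t + 2 * |velocity γ t 0 * velocity γ t 1|))

/-- The Legendre complete elliptic integral of the first kind. -/
def ellipticK (k : ℝ) : ℝ :=
  ∫ θ in (0 : ℝ)..(Real.pi / 2), 1 / Real.sqrt (1 - k ^ 2 * Real.sin θ ^ 2)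

/-- The period `T(k) = √(8(1+k²)) K(k)`. -/
def period (k : ℝ) : ℝ := Real.sqrt (8 * (1 + k ^ 2)) * ellipticK k

end SOL

end

noncomputable section

namespace SOL

/-! Translations in `x` and `y` are isometries, so a unit-speed geodesic has constant momenta `a =
e^{-2z} ẋ` and `b = e^{2z} ẏ`, and its height solves a one-dimensional system. Put `A = |a| e^z`, `B
= |b| e^{-z}`, `c = A B = |a b|`. Then `(A - B)² + ż² = 1 - 2c`, and the point `(-(A - B), ż)` runs
around this circle with angular speed `A + B = √(1 + 2c) √(1 - k² sin² θ)`. Hence the elliptic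
integral of the angle `θ` is affine in time and one turn takes `4 K(k) / √(1 + 2c) = T(k)`
(`isLeast_period`).

For the distance, let `ż(τ) ≠ 0`. Time reversal followed by the isometry `(x, y, z) ↦ (-x, -y, z)`
and a translation gives a second unit-speed curve from `γ(τ)`, with `ż` reversed. As the velocity of
`γ` has period `T`, both curves meet at time `τ + T`. Following the second curve up to there and `γ`
afterwards gives a competitor of the same length with a genuine corner, and cutting the corner makes
it strictly shorter (`eventually_dist_lt_of_corner`, `dist_lt_of_velocity_ne_zero`). If `ż(t₁) = 0`,
a slightly later start `τ` still leaves more than a period. -/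

/-! ### Upper bounds for the Riemannian distance. -/

theorem enorm_tangent (p : SOL) (v : TangentSpace 𝓘(ℝ, EuclideanSpace ℝ (Fin 3)) p) :
    ‖v‖ₑ = ENNReal.ofReal (Real.sqrt (metricAt p v v)) := by
  rw [← ofReal_norm, norm_eq_sqrt_real_inner]
  rfl

/-- The length of a `C¹` curve whose speed is at most `r` bounds the distance of its ends. -/
theorem dist_le_of_speed_le (c : ℝ → EuclideanSpace ℝ (Fin 3)) (hc : ContDiff ℝ 1 c)
    {a b r : ℝ} (hab : a ≤ b)
    (h : ∀ t ∈ Set.Icc a b, metricForm (fun i => c t i) (fun i => deriv c t i)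
      (fun i => deriv c t i) ≤ r ^ 2) (hr : 0 ≤ r) :
    dist (show SOL from c a) (show SOL from c b) ≤ ENNReal.ofReal (r * (b - a)) := by
  have hM : ContMDiffOn 𝓘(ℝ, ℝ) 𝓘(ℝ, EuclideanSpace ℝ (Fin 3)) 1 (fun t => (show SOL from c t))
      (Set.Icc a b) := (contMDiff_iff_contDiff.2 hc).contMDiffOn
  refine (Manifold.riemannianEDist_le_pathELength hM rfl rfl hab).trans ?_
  rw [Manifold.pathELength_eq_lintegral_mfderiv_Icc]
  have hb : ∀ t ∈ Set.Icc a b, ‖mfderiv 𝓘(ℝ, ℝ) 𝓘(ℝ, EuclideanSpace ℝ (Fin 3))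
      (fun t => (show SOL from c t)) t 1‖ₑ ≤ ENNReal.ofReal r := by
    intro t ht
    have hd : mfderiv 𝓘(ℝ, ℝ) 𝓘(ℝ, EuclideanSpace ℝ (Fin 3))
      (fun t => (show SOL from c t)) t 1 = deriv c t := by
      have := mfderiv_eq_fderiv (𝕜 := ℝ) (f := c) (x := t)
      have h2 := congrArg (fun f => f 1) this
      exact h2
    refine (enorm_tangent (show SOL from c t) _).trans_le ?_
    apply ENNReal.ofReal_le_ofReal
    apply Real.sqrt_le_iff.2 ⟨hr, ?_⟩
    refine le_trans (le_of_eq ?_) (h t ht)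
    refine (congrArg (fun v : EuclideanSpace ℝ (Fin 3) => metricCLM (c t) v v) hd).trans ?_
    exact metricCLM_apply _ _ _
  calc _ ≤ ∫⁻ _ in Set.Icc a b, ENNReal.ofReal r :=
        MeasureTheory.setLIntegral_mono' measurableSet_Icc hb
    _ = _ := by
        rw [MeasureTheory.setLIntegral_const, Real.volume_Icc, ENNReal.ofReal_mul hr]

theorem dist_triangle (p q r : SOL) : dist p r ≤ dist p q + dist q r :=
  Manifold.riemannianEDist_triangle

/-- The straight segment from `p` to `q` is compared with its length in the metric at height
`h`. -/
theorem dist_le_of_height_le (p q : SOL) {h δ : ℝ} (hp : |p.coord 2 - h| ≤ δ)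
    (hq : |q.coord 2 - h| ≤ δ) :
    dist p q ≤ ENNReal.ofReal (Real.exp δ *
      Real.sqrt (Real.exp (-2 * h) * (q.coord 0 - p.coord 0) ^ 2 +
        Real.exp (2 * h) * (q.coord 1 - p.coord 1) ^ 2 + (q.coord 2 - p.coord 2) ^ 2)) := by
  let p' : EuclideanSpace ℝ (Fin 3) := p
  let q' : EuclideanSpace ℝ (Fin 3) := q
  let c : ℝ → EuclideanSpace ℝ (Fin 3) := fun t => p' + t • (q' - p')
  have hc : ContDiff ℝ 1 c := by fun_prop
  have hd : ∀ t, deriv c t = q' - p' := by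
    intro t
    have : HasDerivAt c ((1 : ℝ) • (q' - p')) t :=
      ((hasDerivAt_id t).smul_const (q' - p')).const_add p'
    simpa using this.deriv
  have hcp : ∀ i, p.coord i = p' i := fun i => rfl
  have hcq : ∀ i, q.coord i = q' i := fun i => rfl
  set S := Real.exp (-2 * h) * (q.coord 0 - p.coord 0) ^ 2 +
        Real.exp (2 * h) * (q.coord 1 - p.coord 1) ^ 2 + (q.coord 2 - p.coord 2) ^ 2 with hS
  have hS0 : 0 ≤ S := by positivity
  have key := dist_le_of_speed_le c hc (a := 0) (b := 1) (r := Real.exp δ * Real.sqrt S)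
    zero_le_one ?_ (by positivity)
  · have e0 : c 0 = p' := by simp [c]
    have e1 : c 1 = q' := by simp [c]
    rw [e0, e1] at key
    simpa using key
  intro t ht
  rw [hd, mul_pow, Real.sq_sqrt hS0, ← Real.exp_nat_mul]
  have hz : |c t 2 - h| ≤ δ := by
    have : c t 2 - h = (1 - t) * (p.coord 2 - h) + t * (q.coord 2 - h) := by
      rw [hcp, hcq]; simp [c]; ring
    rw [this, abs_le]
    rw [abs_le] at hp hq
    constructor <;> nlinarith [ht.1, ht.2]
  rw [abs_le] at hz
  have hδ : 0 ≤ δ := (abs_nonneg _).trans hp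
  -- Within height `δ` of `h`, each metric coefficient is at most `e^{2δ}` times its value at `h`;
  -- this costs the factor `e^δ` in length.
  have x1 : Real.exp (-2 * c t 2) ≤ Real.exp (2 * δ) * Real.exp (-2 * h) := by
    rw [← Real.exp_add]; apply Real.exp_le_exp.2; linarith
  have x2 : Real.exp (2 * c t 2) ≤ Real.exp (2 * δ) * Real.exp (2 * h) := by
    rw [← Real.exp_add]; apply Real.exp_le_exp.2; linarith
  have x3 : 1 ≤ Real.exp (2 * δ) := Real.one_le_exp (by linarith)
  have y1 := mul_le_mul_of_nonneg_right x1 (sq_nonneg (q.coord 0 - p.coord 0))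
  have y2 := mul_le_mul_of_nonneg_right x2 (sq_nonneg (q.coord 1 - p.coord 1))
  have y3 := mul_le_mul_of_nonneg_right x3 (sq_nonneg (q.coord 2 - p.coord 2))
  have hm : metricForm (fun i => c t i) (fun i => (q' - p') i) (fun i => (q' - p') i) =
      Real.exp (-2 * c t 2) * (q.coord 0 - p.coord 0) ^ 2 +
      Real.exp (2 * c t 2) * (q.coord 1 - p.coord 1) ^ 2 + (q.coord 2 - p.coord 2) ^ 2 := by
    simp only [metricForm, hcp, hcq, PiLp.sub_apply]; ring
  rw [hm, hS]
  push_cast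
  linarith

/-! ### Angle functions and elliptic integrals. -/

theorem exists_angle {P Q : ℝ} (h : P ^ 2 + Q ^ 2 = 1) :
    ∃ θ : ℝ, Real.cos θ = P ∧ Real.sin θ = Q := by
  have hn : ‖(⟨P, Q⟩ : ℂ)‖ = 1 := by
    rw [Complex.norm_def, Complex.normSq_mk, ← sq, ← sq, h, Real.sqrt_one]
  refine ⟨Complex.arg ⟨P, Q⟩, ?_, ?_⟩
  · simpa [hn] using Complex.norm_mul_cos_arg ⟨P, Q⟩
  · simpa [hn] using Complex.norm_mul_sin_arg ⟨P, Q⟩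

/-- A solution of the linear system `P' = -g Q`, `Q' = g P` on the unit circle rotates with
angular speed `g`. -/
theorem exists_angle_function {P Q g : ℝ → ℝ} (hg : Continuous g)
    (hP : ∀ t, HasDerivAt P (-(g t * Q t)) t) (hQ : ∀ t, HasDerivAt Q (g t * P t) t)
    (h : P 0 ^ 2 + Q 0 ^ 2 = 1) :
    ∃ θ : ℝ → ℝ, (∀ t, HasDerivAt θ (g t) t) ∧ (∀ t, P t = Real.cos (θ t)) ∧
      ∀ t, Q t = Real.sin (θ t) := by
  obtain ⟨θ₀, hc, hs⟩ := exists_angle h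
  let θ : ℝ → ℝ := fun t => θ₀ + ∫ s in (0 : ℝ)..t, g s
  have hθ : ∀ t, HasDerivAt θ (g t) t := fun t =>
    (intervalIntegral.integral_hasDerivAt_right (hg.intervalIntegrable _ _)
      (hg.stronglyMeasurableAtFilter _ _) hg.continuousAt).const_add θ₀
  have hθ0 : θ 0 = θ₀ := by simp [θ]
  -- This quantity and the one in `d2` are the cosine and sine of the angle between `(P, Q)` and
  -- `(cos θ, sin θ)`; both are conserved, with initial values `1` and `0`.
  have d1 : ∀ t, HasDerivAt (fun t => P t * Real.cos (θ t) + Q t * Real.sin (θ t)) 0 t := by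
    intro t
    refine (((hP t).mul (hθ t).cos).add ((hQ t).mul (hθ t).sin)).congr_deriv ?_
    ring
  have d2 : ∀ t, HasDerivAt (fun t => Q t * Real.cos (θ t) - P t * Real.sin (θ t)) 0 t := by
    intro t
    refine (((hQ t).mul (hθ t).cos).sub ((hP t).mul (hθ t).sin)).congr_deriv ?_
    ring
  have c1 : ∀ t, P t * Real.cos (θ t) + Q t * Real.sin (θ t) = 1 := by
    intro t
    have := is_const_of_deriv_eq_zero (fun t => (d1 t).differentiableAt)
      (fun t => (d1 t).deriv) t 0
    simp only [hθ0, hc, hs] at this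
    rw [this, ← h]; ring
  have c2 : ∀ t, Q t * Real.cos (θ t) - P t * Real.sin (θ t) = 0 := by
    intro t
    have := is_const_of_deriv_eq_zero (fun t => (d2 t).differentiableAt)
      (fun t => (d2 t).deriv) t 0
    simp only [hθ0, hc, hs] at this
    rw [this]; ring
  refine ⟨θ, hθ, fun t => ?_, fun t => ?_⟩
  · linear_combination Real.cos (θ t) * c1 t - Real.sin (θ t) * c2 t
      - P t * Real.sin_sq_add_cos_sq (θ t)
  · linear_combination Real.sin (θ t) * c1 t + Real.cos (θ t) * c2 t
      - Q t * Real.sin_sq_add_cos_sq (θ t)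

/-- The incomplete elliptic integral of the first kind in terms of the amplitude. -/
def ellipticF (k φ : ℝ) : ℝ := ∫ θ in (0 : ℝ)..φ, 1 / Real.sqrt (1 - k ^ 2 * Real.sin θ ^ 2)

section

variable {k : ℝ}

theorem one_sub_mul_sin_sq_pos (hk0 : 0 ≤ k) (hk : k < 1) (θ : ℝ) :
    0 < 1 - k ^ 2 * Real.sin θ ^ 2 := by
  nlinarith [Real.sin_sq_le_one θ, sq_nonneg (Real.sin θ), sq_nonneg k]

theorem continuous_ellipticF_integrand (hk0 : 0 ≤ k) (hk : k < 1) :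
    Continuous (fun θ => 1 / Real.sqrt (1 - k ^ 2 * Real.sin θ ^ 2)) := by
  refine continuous_const.div (by fun_prop) fun θ => ?_
  exact (Real.sqrt_pos.2 (one_sub_mul_sin_sq_pos hk0 hk θ)).ne'

theorem hasDerivAt_ellipticF (hk0 : 0 ≤ k) (hk : k < 1) (φ : ℝ) :
    HasDerivAt (ellipticF k) (1 / Real.sqrt (1 - k ^ 2 * Real.sin φ ^ 2)) φ :=
  have h := continuous_ellipticF_integrand hk0 hk
  intervalIntegral.integral_hasDerivAt_right (h.intervalIntegrable _ _)
      (h.stronglyMeasurableAtFilter _ _) h.continuousAt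

theorem strictMono_ellipticF (hk0 : 0 ≤ k) (hk : k < 1) : StrictMono (ellipticF k) :=
  strictMono_of_hasDerivAt_pos (hasDerivAt_ellipticF hk0 hk) fun φ =>
    one_div_pos.2 (Real.sqrt_pos.2 (one_sub_mul_sin_sq_pos hk0 hk φ))

theorem ellipticK_pos (hk0 : 0 ≤ k) (hk : k < 1) : 0 < ellipticK k := by
  have := strictMono_ellipticF hk0 hk Real.pi_div_two_pos
  simpa [ellipticF, ellipticK] using this

theorem ellipticF_pi (hk0 : 0 ≤ k) (hk : k < 1) : ellipticF k Real.pi = 2 * ellipticK k := by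
  have h := continuous_ellipticF_integrand hk0 hk
  -- The substitution `θ ↦ π - θ` preserves the integrand.
  have h1 : ∫ θ in (Real.pi / 2)..Real.pi, 1 / Real.sqrt (1 - k ^ 2 * Real.sin θ ^ 2) =
      ellipticK k := by
    have := intervalIntegral.integral_comp_sub_left (a := 0) (b := Real.pi / 2)
      (fun θ => 1 / Real.sqrt (1 - k ^ 2 * Real.sin θ ^ 2)) Real.pi
    simp only [Real.sin_pi_sub, sub_zero] at this
    rw [ellipticK, this, sub_half]
  rw [ellipticF, ← intervalIntegral.integral_add_adjacent_intervals
    (h.intervalIntegrable 0 (Real.pi / 2)) (h.intervalIntegrable _ _), h1, ellipticK]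
  ring

theorem ellipticF_add_pi (hk0 : 0 ≤ k) (hk : k < 1) (φ : ℝ) :
    ellipticF k (φ + Real.pi) = ellipticF k φ + 2 * ellipticK k := by
  have h := continuous_ellipticF_integrand hk0 hk
  have hp : Function.Periodic (fun θ => 1 / Real.sqrt (1 - k ^ 2 * Real.sin θ ^ 2)) Real.pi :=
    fun θ => by simp only [Real.sin_add_pi, neg_sq]
  have := hp.intervalIntegral_add_eq φ 0
  rw [zero_add] at this
  rw [← ellipticF_pi hk0 hk]
  unfold ellipticF
  rw [← this, intervalIntegral.integral_add_adjacent_intervals (h.intervalIntegrable _ _)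
    (h.intervalIntegrable _ _)]

theorem ellipticF_add_two_pi (hk0 : 0 ≤ k) (hk : k < 1) (φ : ℝ) :
    ellipticF k (φ + 2 * Real.pi) = ellipticF k φ + 4 * ellipticK k := by
  rw [two_mul, ← add_assoc, ellipticF_add_pi hk0 hk, ellipticF_add_pi hk0 hk]; ring

end

/-! ### The period of the height. -/

/-- The height `z` along a unit speed geodesic, with momenta `±p` and `±q`, has least period
`period k`. -/
theorem isLeast_period {z v : ℝ → ℝ} {p q k : ℝ} (hp : 0 < p) (hq : 0 < q)
    (hpq : 2 * (p * q) < 1)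
    (hz : ∀ t, HasDerivAt z (v t) t)
    (hv : ∀ t, HasDerivAt v (q ^ 2 * Real.exp (-2 * z t) - p ^ 2 * Real.exp (2 * z t)) t)
    (he : ∀ t, p ^ 2 * Real.exp (2 * z t) + q ^ 2 * Real.exp (-2 * z t) + v t ^ 2 = 1)
    (hk : k = Real.sqrt ((1 - 2 * (p * q)) / (1 + 2 * (p * q)))) :
    IsLeast {τ : ℝ | 0 < τ ∧ ∀ t, z (t + τ) = z t} (period k) := by
  have hc : 0 < p * q := mul_pos hp hq
  set c := p * q with hcdef
  have hden : 0 < 1 + 2 * c := by linarith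
  have hk0 : 0 ≤ k := hk ▸ Real.sqrt_nonneg _
  have hk2 : k ^ 2 = (1 - 2 * c) / (1 + 2 * c) := by
    rw [hk, Real.sq_sqrt (div_nonneg (by linarith) hden.le)]
  have hk1 : k < 1 := by
    have : k ^ 2 < 1 := by rw [hk2, div_lt_one hden]; linarith
    nlinarith
  set r := Real.sqrt (1 - 2 * c) with hr
  have hr2 : r ^ 2 = 1 - 2 * c := Real.sq_sqrt (by linarith)
  have hr0 : 0 < r := Real.sqrt_pos.2 (by linarith)
  set w := Real.sqrt (1 + 2 * c) with hw
  have hw2 : w ^ 2 = 1 + 2 * c := Real.sq_sqrt hden.le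
  have hw0 : 0 < w := Real.sqrt_pos.2 hden
  -- This is `1 + k² = 2 / w²`.
  have hT : period k = 4 * ellipticK k / w := by
    have : Real.sqrt (8 * (1 + k ^ 2)) = 4 / w := by
      rw [show 8 * (1 + k ^ 2) = (4 / w) ^ 2 by rw [div_pow, hw2, hk2]; field_simp; ring]
      exact Real.sqrt_sq (by positivity)
    rw [period, this]; ring
  have hTpos : 0 < period k := by
    rw [hT]; have := ellipticK_pos hk0 hk1; positivity
  -- the two exponentials
  let A : ℝ → ℝ := fun t => p * Real.exp (z t)
  let B : ℝ → ℝ := fun t => q * Real.exp (-z t)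
  have hA2 : ∀ t, A t ^ 2 = p ^ 2 * Real.exp (2 * z t) := fun t => by
    simp only [A, mul_pow, ← Real.exp_nat_mul]; push_cast; ring_nf
  have hB2 : ∀ t, B t ^ 2 = q ^ 2 * Real.exp (-2 * z t) := fun t => by
    simp only [B, mul_pow, ← Real.exp_nat_mul]; push_cast; ring_nf
  have hAB : ∀ t, A t * B t = c := fun t => by
    have : Real.exp (z t) * Real.exp (-z t) = 1 := by rw [← Real.exp_add]; simp
    simp only [A, B]; linear_combination p * q * this
  have dA : ∀ t, HasDerivAt A (A t * v t) t := fun t =>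
    ((hz t).exp.const_mul p).congr_deriv (by simp only [A]; ring)
  have dB : ∀ t, HasDerivAt B (-(B t * v t)) t := fun t =>
    ((hz t).neg.exp.const_mul q).congr_deriv (by simp only [B, Pi.neg_apply]; ring)
  have he' : ∀ t, A t ^ 2 + B t ^ 2 + v t ^ 2 = 1 := fun t => by rw [hA2, hB2]; exact he t
  have hgpos : ∀ t, 0 < A t + B t := fun t => by simp only [A, B]; positivity
  -- From `(A - B)' = (A + B) v` and `v' = B² - A² = -(A + B)(A - B)`, the normalized pair rotates
  -- with angular speed `A + B`.
  obtain ⟨θ, hθ, hcos, hsin⟩ := exists_angle_function (g := fun t => A t + B t)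
    (P := fun t => -(A t - B t) / r) (Q := fun t => v t / r)
    (continuous_iff_continuousAt.2 fun t => ((dA t).add (dB t)).continuousAt)
    (fun t => (((dA t).sub (dB t)).neg.div_const r).congr_deriv (by ring))
    (fun t => ((hv t).div_const r).congr_deriv (by rw [← hA2, ← hB2]; ring))
    (by
      field_simp
      rw [hr2]; linear_combination he' 0 - 2 * hAB 0)
  -- Here `(A + B)² = 1 + 2c - v²`, with `v = r sin θ` and `r² = k² w²`.
  have hspeed : ∀ t, A t + B t = w * Real.sqrt (1 - k ^ 2 * Real.sin (θ t) ^ 2) := fun t => by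
    rw [← hsin, hw, ← Real.sqrt_mul hden.le, eq_comm, Real.sqrt_eq_iff_eq_sq _ (hgpos t).le]
    · rw [hk2, div_pow, hr2]
      have : (1 - 2 * c) ≠ 0 := by linarith
      field_simp
      linear_combination -he' t - 2 * hAB t
    · exact mul_nonneg hden.le (one_sub_mul_sin_sq_pos hk0 hk1 _).le |>.trans_eq (by rw [hsin])
  have hF : ∀ t, ellipticF k (θ t) = ellipticF k (θ 0) + w * t := by
    have d : ∀ t, HasDerivAt (fun t => ellipticF k (θ t) - w * t) 0 t := fun t => by
      refine (((hasDerivAt_ellipticF hk0 hk1 (θ t)).comp t (hθ t)).sub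
        ((hasDerivAt_id t).const_mul w)).congr_deriv ?_
      have := (Real.sqrt_pos.2 (one_sub_mul_sin_sq_pos hk0 hk1 (θ t))).ne'
      simp only [hspeed]
      field_simp
      ring
    intro t
    have := is_const_of_deriv_eq_zero (fun t => (d t).differentiableAt)
      (fun t => (d t).deriv) t 0
    simp only [mul_zero, sub_zero] at this
    linarith
  have hinj := (strictMono_ellipticF hk0 hk1).injective
  have hper : ∀ t, θ (t + period k) = θ t + 2 * Real.pi := fun t => by
    apply hinj
    rw [ellipticF_add_two_pi hk0 hk1, hF (t + _), hF t, hT]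
    field_simp
    ring
  have hmono : StrictMono θ := strictMono_of_hasDerivAt_pos hθ hgpos
  -- The cosine determines `A - B`, a strictly increasing function of `z`.
  have zinj : ∀ s t, Real.cos (θ s) = Real.cos (θ t) → z s = z t := by
    have hlt : ∀ s t, z s < z t → A s - B s < A t - B t := fun s t h => by
      have h1 := mul_lt_mul_of_pos_left (Real.exp_lt_exp.2 h) hp
      have h2 := mul_lt_mul_of_pos_left (Real.exp_lt_exp.2 (neg_lt_neg h)) hq
      simp only [A, B]; linarith
    intro s t h
    rw [← hcos, ← hcos, div_left_inj' hr0.ne', neg_inj] at h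
    rcases lt_trichotomy (z s) (z t) with h' | h' | h'
    · exact absurd h (hlt _ _ h').ne
    · exact h'
    · exact absurd h (hlt _ _ h').ne'
  refine ⟨⟨hTpos, fun t => zinj _ _ ?_⟩, ?_⟩
  · rw [hper, Real.cos_add_two_pi]
  rintro τ ⟨hτ, hzτ⟩
  -- A shorter period would restore `z` and, by differentiation, `v`, hence both cosine and sine of
  -- `θ`; but `θ` has advanced by an amount strictly between `0` and `2π`.
  by_contra! hlt
  have hvτ : v τ = v 0 := by
    have h1 : HasDerivAt z (v (0 + τ)) 0 := by
      have := (hz (0 + τ)).comp_add_const 0 τ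
      simpa only [hzτ] using this
    simpa using h1.unique (hz 0)
  have hz0 : z τ = z 0 := by simpa using hzτ 0
  have e1 : Real.cos (θ τ) = Real.cos (θ 0) := by
    rw [← hcos, ← hcos]; simp only [A, B, hz0]
  have e2 : Real.sin (θ τ) = Real.sin (θ 0) := by
    rw [← hsin, ← hsin, hvτ]
  have e3 : Real.cos (θ τ - θ 0) = 1 := by
    rw [Real.cos_sub, e1, e2, ← sq, ← sq, Real.cos_sq_add_sin_sq]
  have l1 : θ 0 < θ τ := hmono hτ
  have l2 : θ τ < θ 0 + 2 * Real.pi := by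
    have := hper 0
    rw [zero_add] at this
    rw [← this]; exact hmono hlt
  have := (Real.cos_eq_one_iff_of_lt_of_lt (by linarith [Real.pi_pos]) (by linarith)).1 e3
  linarith

open Filter Topology

/-! ### Euler-Lagrange equations and first integrals. -/

theorem lagrangianDv_zero (q v : Fin 3 → ℝ) :
    lagrangianDv 0 q v = Real.exp (-2 * q 2) * v 0 := by
  have h : HasDerivAt (fun s => lagrangian q (Function.update v 0 s))
      (1 / 2 * (Real.exp (-2 * q 2) * (1 * v 0 + v 0 * 1))) (v 0) := by
    simp only [lagrangian, metricForm, Function.update_self,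
      Function.update_of_ne (show (1 : Fin 3) ≠ 0 by decide),
      Function.update_of_ne (show (2 : Fin 3) ≠ 0 by decide)]
    exact (((((hasDerivAt_id (v 0)).mul (hasDerivAt_id (v 0))).const_mul _).add_const _).add_const
      _).const_mul _
  rw [lagrangianDv, h.deriv]; ring

theorem lagrangianDv_one (q v : Fin 3 → ℝ) :
    lagrangianDv 1 q v = Real.exp (2 * q 2) * v 1 := by
  have h : HasDerivAt (fun s => lagrangian q (Function.update v 1 s))
      (1 / 2 * (Real.exp (2 * q 2) * (1 * v 1 + v 1 * 1))) (v 1) := by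
    simp only [lagrangian, metricForm, Function.update_self,
      Function.update_of_ne (show (0 : Fin 3) ≠ 1 by decide),
      Function.update_of_ne (show (2 : Fin 3) ≠ 1 by decide)]
    exact (((((hasDerivAt_id (v 1)).mul (hasDerivAt_id (v 1))).const_mul _).const_add _).add_const
      _).const_mul _
  rw [lagrangianDv, h.deriv]; ring

theorem lagrangianDv_two (q v : Fin 3 → ℝ) : lagrangianDv 2 q v = v 2 := by
  have h : HasDerivAt (fun s => lagrangian q (Function.update v 2 s))
      (1 / 2 * (1 * v 2 + v 2 * 1)) (v 2) := by
    simp only [lagrangian, metricForm, Function.update_self,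
      Function.update_of_ne (show (0 : Fin 3) ≠ 2 by decide),
      Function.update_of_ne (show (1 : Fin 3) ≠ 2 by decide)]
    exact (((hasDerivAt_id (v 2)).mul (hasDerivAt_id (v 2))).const_add _).const_mul _
  rw [lagrangianDv, h.deriv]; ring

theorem lagrangianDq_zero (q v : Fin 3 → ℝ) : lagrangianDq 0 q v = 0 := by
  simp [lagrangianDq, lagrangian, metricForm]

theorem lagrangianDq_one (q v : Fin 3 → ℝ) : lagrangianDq 1 q v = 0 := by
  simp [lagrangianDq, lagrangian, metricForm]

theorem lagrangianDq_two (q v : Fin 3 → ℝ) :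
    lagrangianDq 2 q v = Real.exp (2 * q 2) * v 1 ^ 2 - Real.exp (-2 * q 2) * v 0 ^ 2 := by
  have h : HasDerivAt (fun s => lagrangian (Function.update q 2 s) v)
      (1 / 2 * (Real.exp (-2 * q 2) * (-2 * 1) * (v 0 * v 0) +
        Real.exp (2 * q 2) * (2 * 1) * (v 1 * v 1))) (q 2) := by
    simp only [lagrangian, metricForm, Function.update_self]
    exact (((((hasDerivAt_id (q 2)).const_mul _).exp.mul_const _).add
      (((hasDerivAt_id (q 2)).const_mul _).exp.mul_const _)).add_const _).const_mul _
  rw [lagrangianDq, h.deriv]; ring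

theorem IsGeodesic.contDiff {γ : ℝ → SOL} (hγ : IsGeodesic γ) :
    ContDiff ℝ ∞ (fun t => (show EuclideanSpace ℝ (Fin 3) from γ t)) :=
  contMDiff_iff_contDiff.1 hγ.smooth

theorem hasDerivAt_apply_of_euclidean {c : ℝ → EuclideanSpace ℝ (Fin 3)}
    {c' : EuclideanSpace ℝ (Fin 3)} {t : ℝ} (h : HasDerivAt c c' t) (i : Fin 3) :
    HasDerivAt (fun s => c s i) (c' i) t :=
  (EuclideanSpace.proj (𝕜 := ℝ) i).hasFDerivAt.comp_hasDerivAt t h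

theorem IsGeodesic.hasDerivAt_coord {γ : ℝ → SOL} (hγ : IsGeodesic γ) (i : Fin 3) (t : ℝ) :
    HasDerivAt (fun s => (γ s).coord i) (velocity γ t i) t := by
  have h := hγ.contDiff.differentiable (by simp) t
  have h2 := hasDerivAt_apply_of_euclidean h.hasDerivAt i
  exact h2.differentiableAt.hasDerivAt

theorem IsGeodesic.exists_momentum_zero {γ : ℝ → SOL} (hγ : IsGeodesic γ) :
    ∃ a : ℝ, ∀ t, velocity γ t 0 = a * Real.exp (2 * (γ t).coord 2) := by
  have h := hγ.eulerLagrange 0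
  simp only [lagrangianDv_zero, lagrangianDq_zero] at h
  refine ⟨Real.exp (-2 * (γ 0).coord 2) * velocity γ 0 0, fun t => ?_⟩
  rw [← is_const_of_deriv_eq_zero (fun t => (h t).differentiableAt) (fun t => (h t).deriv) t 0,
    mul_right_comm, ← Real.exp_add]
  simp

theorem IsGeodesic.exists_momentum_one {γ : ℝ → SOL} (hγ : IsGeodesic γ) :
    ∃ b : ℝ, ∀ t, velocity γ t 1 = b * Real.exp (-2 * (γ t).coord 2) := by
  have h := hγ.eulerLagrange 1
  simp only [lagrangianDv_one, lagrangianDq_one] at h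
  refine ⟨Real.exp (2 * (γ 0).coord 2) * velocity γ 0 1, fun t => ?_⟩
  rw [← is_const_of_deriv_eq_zero (fun t => (h t).differentiableAt) (fun t => (h t).deriv) t 0,
    mul_right_comm, ← Real.exp_add]
  simp

theorem exp_neg_mul_sq_mul_exp (a s : ℝ) :
    Real.exp (-2 * s) * (a * Real.exp (2 * s)) ^ 2 = a ^ 2 * Real.exp (2 * s) := by
  have : Real.exp (-2 * s) * Real.exp (2 * s) = 1 := by rw [← Real.exp_add]; simp
  linear_combination a ^ 2 * Real.exp (2 * s) * this

theorem exp_mul_sq_mul_exp_neg (b s : ℝ) :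
    Real.exp (2 * s) * (b * Real.exp (-2 * s)) ^ 2 = b ^ 2 * Real.exp (-2 * s) := by
  have : Real.exp (2 * s) * Real.exp (-2 * s) = 1 := by rw [← Real.exp_add]; simp
  linear_combination b ^ 2 * Real.exp (-2 * s) * this

theorem coordConst_of_velocity_eq_zero {γ : ℝ → SOL} (hγ : IsGeodesic γ) {i : Fin 3}
    (h : ∀ t, velocity γ t i = 0) : CoordConst γ i := fun s t =>
  is_const_of_deriv_eq_zero (fun t => (hγ.hasDerivAt_coord i t).differentiableAt)
    (fun t => (hγ.hasDerivAt_coord i t).deriv.trans (h t)) s t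

/-- The first integrals of a generic unit speed geodesic. -/
theorem IsGenericGeodesic.exists_momenta {γ : ℝ → SOL} (hγ : IsGenericGeodesic γ)
    (hunit : ∀ t, speedSq γ t = 1) :
    ∃ a b : ℝ, a ≠ 0 ∧ b ≠ 0 ∧ 2 * (|a| * |b|) < 1 ∧
      (∀ t, velocity γ t 0 = a * Real.exp (2 * (γ t).coord 2)) ∧
      (∀ t, velocity γ t 1 = b * Real.exp (-2 * (γ t).coord 2)) ∧
      (∀ t, HasDerivAt (fun s => velocity γ s 2)
        (b ^ 2 * Real.exp (-2 * (γ t).coord 2) - a ^ 2 * Real.exp (2 * (γ t).coord 2)) t) ∧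
      ∀ t, a ^ 2 * Real.exp (2 * (γ t).coord 2) + b ^ 2 * Real.exp (-2 * (γ t).coord 2) +
        velocity γ t 2 ^ 2 = 1 := by
  have hg := hγ.isGeodesic
  obtain ⟨a, ha⟩ := hg.exists_momentum_zero
  obtain ⟨b, hb⟩ := hg.exists_momentum_one
  have hE : ∀ t, a ^ 2 * Real.exp (2 * (γ t).coord 2) + b ^ 2 * Real.exp (-2 * (γ t).coord 2) +
      velocity γ t 2 ^ 2 = 1 := fun t => by
    rw [← hunit t, speedSq, metricForm, ha, hb, ← exp_neg_mul_sq_mul_exp,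
      ← exp_mul_sq_mul_exp_neg]
    ring
  refine ⟨a, b, ?_, ?_, ?_, ha, hb, fun t => ?_, hE⟩
  · rintro rfl
    exact hγ.not_hyperbolic (Or.inl (coordConst_of_velocity_eq_zero hg (by simp [ha])))
  · rintro rfl
    exact hγ.not_hyperbolic (Or.inr (coordConst_of_velocity_eq_zero hg (by simp [hb])))
  · by_contra! hle
    refine hγ.not_horizontal (coordConst_of_velocity_eq_zero hg fun t => ?_)
    have h1 : Real.exp (2 * (γ t).coord 2) = Real.exp ((γ t).coord 2) ^ 2 := by
      rw [← Real.exp_nat_mul]; norm_num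
    have h2 : Real.exp (-2 * (γ t).coord 2) = Real.exp (-(γ t).coord 2) ^ 2 := by
      rw [← Real.exp_nat_mul]; congr 1; push_cast; ring
    have h3 : Real.exp ((γ t).coord 2) * Real.exp (-(γ t).coord 2) = 1 := by
      rw [← Real.exp_add]; simp
    have h4 := hE t
    rw [h1, h2, ← sq_abs a, ← sq_abs b] at h4
    have h5 := sq_nonneg (|a| * Real.exp ((γ t).coord 2) - |b| * Real.exp (-(γ t).coord 2))
    -- The energy identity with its square completed: if `2|a||b| ≥ 1`, the right side is
    -- nonpositive and `ż` must vanish.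
    have h6 : (|a| * Real.exp ((γ t).coord 2) - |b| * Real.exp (-(γ t).coord 2)) ^ 2 +
        velocity γ t 2 ^ 2 = 1 - 2 * (|a| * |b|) := by
      linear_combination h4 - 2 * |a| * |b| * h3
    have h7 : velocity γ t 2 ^ 2 = 0 :=
      le_antisymm (by linarith) (sq_nonneg _)
    exact pow_eq_zero_iff (two_ne_zero) |>.1 h7
  · have h := hg.eulerLagrange 2 t
    simp only [lagrangianDv_two, lagrangianDq_two] at h
    rwa [ha, hb, exp_neg_mul_sq_mul_exp, exp_mul_sq_mul_exp_neg] at h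

/-! ### Shortening at a corner. -/

/-- Cutting a corner: two curves leave `P` with velocities `-u` and `v`, where
`‖u + v‖ < 2`. -/
theorem eventually_dist_lt_of_corner {α β : ℝ → SOL} {P u v : Fin 3 → ℝ}
    (hα : ∀ i, HasDerivAt (fun s => (α s).coord i) (-u i) 0)
    (hβ : ∀ i, HasDerivAt (fun s => (β s).coord i) (v i) 0)
    (hα0 : (α 0).coord = P) (hβ0 : (β 0).coord = P)
    (huv : metricForm P (u + v) (u + v) < 4) :
    ∀ᶠ s in 𝓝[>] (0 : ℝ), dist (α s) (β s) < ENNReal.ofReal (2 * s) := by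
  have hslope : ∀ i, Tendsto (fun s => ((β s).coord i - (α s).coord i) / s) (𝓝[>] 0)
      (𝓝 ((u + v) i)) := fun i => by
    have h := (((hβ i).sub (hα i)).tendsto_slope_zero_right)
    have e : v i - -u i = (u + v) i := by simp [add_comm]
    rw [e] at h
    refine h.congr fun s => ?_
    simp only [Pi.sub_apply, zero_add, hα0, hβ0, sub_self, sub_zero, smul_eq_mul]
    rw [div_eq_inv_mul]
  have hcα : Tendsto (fun s => (α s).coord 2) (𝓝[>] 0) (𝓝 (P 2)) := by
    rw [← hα0]; exact (hα 2).continuousAt.tendsto.mono_left nhdsWithin_le_nhds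
  have hcβ : Tendsto (fun s => (β s).coord 2) (𝓝[>] 0) (𝓝 (P 2)) := by
    rw [← hβ0]; exact (hβ 2).continuousAt.tendsto.mono_left nhdsWithin_le_nhds
  have hδ : Tendsto (fun s => |(α s).coord 2 - P 2| + |(β s).coord 2 - P 2|) (𝓝[>] 0) (𝓝 0) := by
    have := (hcα.sub_const (P 2)).abs.add (hcβ.sub_const (P 2)).abs
    simpa using this
  -- The bound of `dist_le_of_height_le`, divided by `s`, tends to the norm of `u + v` at `P`, which
  -- is less than `2`.
  have hlim : Tendsto (fun s => Real.exp (|(α s).coord 2 - P 2| + |(β s).coord 2 - P 2|) *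
      Real.sqrt (Real.exp (-2 * P 2) * (((β s).coord 0 - (α s).coord 0) / s) ^ 2 +
        Real.exp (2 * P 2) * (((β s).coord 1 - (α s).coord 1) / s) ^ 2 +
        (((β s).coord 2 - (α s).coord 2) / s) ^ 2)) (𝓝[>] 0)
      (𝓝 (Real.exp 0 * Real.sqrt (Real.exp (-2 * P 2) * (u + v) 0 ^ 2 +
        Real.exp (2 * P 2) * (u + v) 1 ^ 2 + (u + v) 2 ^ 2))) :=
    (Real.continuous_exp.continuousAt.tendsto.comp hδ).mul
      (((((hslope 0).pow 2).const_mul _).add (((hslope 1).pow 2).const_mul _)).add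
        ((hslope 2).pow 2)).sqrt
  have hlt : Real.exp 0 * Real.sqrt (Real.exp (-2 * P 2) * (u + v) 0 ^ 2 +
        Real.exp (2 * P 2) * (u + v) 1 ^ 2 + (u + v) 2 ^ 2) < 2 := by
    rw [Real.exp_zero, one_mul, Real.sqrt_lt' two_pos]
    refine lt_of_eq_of_lt ?_ (huv.trans_eq (by norm_num))
    simp only [metricForm]; ring
  filter_upwards [hlim.eventually_lt_const hlt, self_mem_nhdsWithin] with s hs hs0
  have hs0' : 0 < s := hs0
  refine (dist_le_of_height_le (α s) (β s) (h := P 2)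
    (δ := |(α s).coord 2 - P 2| + |(β s).coord 2 - P 2|) (by simp) (by simp)).trans_lt ?_
  rw [ENNReal.ofReal_lt_ofReal_iff (by positivity)]
  refine lt_of_eq_of_lt ?_ (mul_lt_mul_of_pos_right hs hs0')
  rw [mul_assoc]
  congr 1
  refine Eq.trans ?_ (congrArg (_ * ·) (Real.sqrt_sq hs0'.le))
  rw [← Real.sqrt_mul (by positivity)]
  congr 1
  field_simp

/-! ### The reflected competitor. -/

theorem IsGeodesic.dist_le {γ : ℝ → SOL} (hγ : IsGeodesic γ) (hunit : ∀ t, speedSq γ t = 1)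
    {s t : ℝ} (hst : s ≤ t) : dist (γ s) (γ t) ≤ ENNReal.ofReal (t - s) := by
  have h := dist_le_of_speed_le (fun t => (show EuclideanSpace ℝ (Fin 3) from γ t))
    (hγ.contDiff.of_le (by simp)) (r := 1) hst (fun t _ => ?_) zero_le_one
  · simpa using h
  refine le_of_eq ?_
  have hd := hasDerivAt_apply_of_euclidean (hγ.contDiff.differentiable (by simp) t).hasDerivAt
  have : (fun i => deriv (fun t => (show EuclideanSpace ℝ (Fin 3) from γ t)) t i) =
      velocity γ t := funext fun i => ((hd i).deriv).symm
  rw [this, one_pow, ← hunit t]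
  rfl

/-- The image of the time reversal of `γ` at `τ` under `(x, y, z) ↦ (-x, -y, z)`, up to
translation: the geodesic through `γ τ` whose velocity differs by the sign of `ż`. -/
def reflected (γ : ℝ → SOL) (τ t : ℝ) : EuclideanSpace ℝ (Fin 3) :=
  !₂[2 * (γ τ).coord 0 - (γ (2 * τ - t)).coord 0, 2 * (γ τ).coord 1 - (γ (2 * τ - t)).coord 1,
    (γ (2 * τ - t)).coord 2]

/-- The metric sees neither the common sign of `ẋ, ẏ` nor that of `ż`, so the reflected curve at
time `t` has the speed of `γ` at `2τ - t`, namely `1`. -/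
theorem dist_reflected_le {γ : ℝ → SOL} (hγ : IsGeodesic γ) (hunit : ∀ t, speedSq γ t = 1)
    (τ : ℝ) {s t : ℝ} (hst : s ≤ t) :
    dist (show SOL from reflected γ τ s) (show SOL from reflected γ τ t) ≤
      ENNReal.ofReal (t - s) := by
  have hco : ∀ i, ContDiff ℝ 1 (fun t => (γ t).coord i) := fun i =>
    contDiff_euclidean.1 (hγ.contDiff.of_le (by simp)) i
  have hco' : ∀ i, ContDiff ℝ 1 (fun t => (γ (2 * τ - t)).coord i) := fun i =>
    (hco i).comp (contDiff_const.sub contDiff_id)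
  have hc : ContDiff ℝ 1 (reflected γ τ) := by
    rw [contDiff_euclidean]
    intro i
    fin_cases i
    · exact contDiff_const.sub (hco' 0)
    · exact contDiff_const.sub (hco' 1)
    · exact hco' 2
  have h := dist_le_of_speed_le (reflected γ τ) hc (r := 1) hst (fun t _ => ?_) zero_le_one
  · simpa using h
  refine le_of_eq ?_
  have hd := hasDerivAt_apply_of_euclidean (hc.differentiable (by simp) t).hasDerivAt
  have hr : ∀ i, HasDerivAt (fun t => (γ (2 * τ - t)).coord i) (-velocity γ (2 * τ - t) i) t :=
    fun i => (hγ.hasDerivAt_coord i (2 * τ - t)).comp_const_sub (2 * τ) t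
  have d0 := (hd 0).unique ((hr 0).const_sub (2 * (γ τ).coord 0))
  have d1 := (hd 1).unique ((hr 1).const_sub (2 * (γ τ).coord 1))
  have d2 := (hd 2).unique (hr 2)
  rw [one_pow, ← hunit (2 * τ - t)]
  simp only [speedSq, metricForm, d0, d1, d2, neg_neg, neg_mul_neg]
  rfl

/-- The increment of `f` over any interval of length `T` is the same. Applied to `x` and `y`, this
makes the reflected curve meet `γ` at time `τ + T`. -/
theorem add_sub_eq_of_periodic_deriv {f f' : ℝ → ℝ} {T : ℝ} (hf : ∀ t, HasDerivAt f (f' t) t)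
    (hp : ∀ t, f' (t + T) = f' t) (τ : ℝ) : 2 * f τ - f (τ - T) = f (τ + T) := by
  have d : ∀ t, HasDerivAt (fun t => f (t + T) - f t) 0 t := fun t =>
    (((hf (t + T)).comp_add_const t T).sub (hf t)).congr_deriv (by rw [hp, sub_self])
  have := is_const_of_deriv_eq_zero (fun t => (d t).differentiableAt)
      (fun t => (d t).deriv) τ (τ - T)
  simp only [sub_add_cancel] at this
  linarith

/-- Beyond a common period of the momenta, a geodesic with `ż ≠ 0` is beaten by the broken
geodesic that starts along its reflection. -/
theorem dist_lt_of_velocity_ne_zero {γ : ℝ → SOL} (hγ : IsGeodesic γ)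
    (hunit : ∀ t, speedSq γ t = 1) {T τ t : ℝ} (hT : 0 < T)
    (hz : ∀ t, (γ (t + T)).coord 2 = (γ t).coord 2)
    (hv : ∀ i t, velocity γ (t + T) i = velocity γ t i)
    (hτ : velocity γ τ 2 ≠ 0) (ht : τ + T < t) :
    dist (γ τ) (γ t) < ENNReal.ofReal (t - τ) := by
  have hzb : (γ (τ - T)).coord 2 = (γ τ).coord 2 := by simpa using (hz (τ - T)).symm
  have hvb : ∀ i, velocity γ (τ - T) i = velocity γ τ i := fun i => by
    simpa using (hv i (τ - T)).symm
  have h20 : 2 * τ - (τ + T) = τ - T := by ring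
  -- One branch of the corner runs back along the reflected curve from its meeting with `γ`; the
  -- other, in `hβ`, runs forward along `γ`.
  have hα : ∀ i, HasDerivAt (fun s => (show SOL from reflected γ τ (τ + T - s)).coord i)
      (-(![velocity γ τ 0, velocity γ τ 1, -velocity γ τ 2] : Fin 3 → ℝ) i) 0 := by
    have hr : ∀ i, HasDerivAt (fun s => (γ (2 * τ - (τ + T - s))).coord i)
        (velocity γ τ i) 0 := fun i => by
      have h := hγ.hasDerivAt_coord i (τ - T + 0)
      have h' := h.comp_const_add (τ - T) 0
      rw [add_zero, hvb] at h'
      refine h'.congr_of_eventuallyEq (Eventually.of_forall fun s => ?_)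
      simp only
      congr 2; ring
    intro i
    fin_cases i
    · exact (hr 0).const_sub _
    · exact (hr 1).const_sub _
    · exact (hr 2).congr_deriv (neg_neg _).symm
  have hβ : ∀ i, HasDerivAt (fun s => (γ (τ + T + s)).coord i) (velocity γ τ i) 0 := fun i => by
    have h' := (hγ.hasDerivAt_coord i (τ + T + 0)).comp_const_add (τ + T) 0
    rwa [add_zero, hv] at h'
  have hα0 : (show SOL from reflected γ τ (τ + T - 0)).coord = (γ (τ + T)).coord := by
    rw [sub_zero]
    funext i
    fin_cases i
    · refine Eq.trans ?_ (add_sub_eq_of_periodic_deriv (hγ.hasDerivAt_coord 0) (hv 0) τ)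
      rw [← h20]; rfl
    · refine Eq.trans ?_ (add_sub_eq_of_periodic_deriv (hγ.hasDerivAt_coord 1) (hv 1) τ)
      rw [← h20]; rfl
    · refine Eq.trans ?_ (hzb.trans (hz τ).symm)
      rw [← h20]; rfl
  -- The sum of the velocities is `(2ẋ, 2ẏ, 0)`, of squared norm `4(1 - ż²)`.
  have hlt4 : metricForm (γ (τ + T)).coord
      ((![velocity γ τ 0, velocity γ τ 1, -velocity γ τ 2] : Fin 3 → ℝ) + velocity γ τ)
      ((![velocity γ τ 0, velocity γ τ 1, -velocity γ τ 2] : Fin 3 → ℝ) + velocity γ τ) < 4 := by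
    have h1 := hunit τ
    have h2 : 0 < velocity γ τ 2 ^ 2 := by positivity
    simp only [speedSq, metricForm, neg_mul] at h1
    simp [metricForm, hz]
    nlinarith
  have hev := eventually_dist_lt_of_corner hα hβ hα0 (by rw [add_zero]) hlt4
  -- The two bounds on `s` keep the cut after time `τ` on the reflected curve and before time `t` on
  -- `γ`.
  obtain ⟨s, hs, hs0, hs1⟩ := (hev.and (Ioo_mem_nhdsGT (lt_min hT (sub_pos.2 ht)))).exists
  have hsT := hs1.trans_le (min_le_left _ _)
  have hst := hs1.trans_le (min_le_right _ _)
  have e0 : (show SOL from reflected γ τ τ) = γ τ := by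
    have : (reflected γ τ τ : EuclideanSpace ℝ (Fin 3)) =
        (show EuclideanSpace ℝ (Fin 3) from γ τ) := by
      ext i
      have h1 : 2 * τ - τ = τ := by ring
      fin_cases i
      · simp [reflected, two_mul]; rfl
      · simp [reflected, two_mul]; rfl
      · simp [reflected, h1]; rfl
    exact this
  have l1 := dist_reflected_le hγ hunit τ (s := τ) (t := τ + T - s) (by linarith)
  rw [e0] at l1
  have l2 := hγ.dist_le hunit (s := τ + T + s) (t := t) (by linarith)
  calc dist (γ τ) (γ t)
      ≤ dist (γ τ) (show SOL from reflected γ τ (τ + T - s)) +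
        (dist (show SOL from reflected γ τ (τ + T - s)) (γ (τ + T + s)) +
          dist (γ (τ + T + s)) (γ t)) :=
        (dist_triangle _ _ _).trans (add_le_add le_rfl (dist_triangle _ _ _))
    _ < ENNReal.ofReal (τ + T - s - τ) + (ENNReal.ofReal (2 * s) +
          ENNReal.ofReal (t - (τ + T + s))) :=
        ENNReal.add_lt_add_of_le_of_lt (l1.trans_lt ENNReal.ofReal_lt_top).ne l1
          (ENNReal.add_lt_add_of_lt_of_le (l2.trans_lt ENNReal.ofReal_lt_top).ne hs l2)
    _ = ENNReal.ofReal (t - τ) := by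
        rw [← ENNReal.ofReal_add (by linarith) (by linarith),
          ← ENNReal.ofReal_add (by linarith) (by linarith)]
        congr 1; ring

end SOL

end

/-! ### Choice of the starting time and conclusion. -/

theorem mainTheorem4 (γ : ℝ → SOL) (hγ : SOL.IsGenericGeodesic γ)
    (hunit : ∀ t : ℝ, SOL.speedSq γ t = 1) (k t₀ : ℝ) (hk : SOL.modulus γ t₀ = k) :
    IsLeast {τ : ℝ | 0 < τ ∧ ∀ t : ℝ, (γ (t + τ)).coord 2 = (γ t).coord 2} (SOL.period k) ∧
      ∀ t₁ t₂ : ℝ, SOL.period k < t₂ - t₁ →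
        SOL.dist (γ t₁) (γ t₂) < ENNReal.ofReal (t₂ - t₁) := by
  have hg := hγ.isGeodesic
  obtain ⟨a, b, ha, hb, hab, hx, hy, hv, hE⟩ := hγ.exists_momenta hunit
  have hprod : |SOL.velocity γ t₀ 0 * SOL.velocity γ t₀ 1| = |a| * |b| := by
    have : Real.exp (2 * (γ t₀).coord 2) * Real.exp (-2 * (γ t₀).coord 2) = 1 := by
      rw [← Real.exp_add]; simp
    rw [← abs_mul, hx, hy]
    congr 1
    linear_combination a * b * this
  have hleast := SOL.isLeast_period (k := k) (abs_pos.2 ha) (abs_pos.2 hb) hab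
    (hg.hasDerivAt_coord 2) (by simpa only [sq_abs] using hv) (by simpa only [sq_abs] using hE)
    (by rw [← hk, SOL.modulus, hprod, hunit])
  refine ⟨hleast, fun t₁ t₂ h12 => ?_⟩
  obtain ⟨hT, hz⟩ := hleast.1
  set T := SOL.period k
  have hvel : ∀ i t, SOL.velocity γ (t + T) i = SOL.velocity γ t i := by
    intro i t
    fin_cases i
    · simp [hx, hz]
    · simp [hy, hz]
    · have h1 := (hg.hasDerivAt_coord 2 (t + T)).comp_add_const t T
      simp only [hz] at h1
      exact h1.unique (hg.hasDerivAt_coord 2 t)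
  -- If `ż` vanished on the whole interval, so would `z̈`; then `a² e^{2z} = b² e^{-2z} = 1/2` and
  -- `|a||b| = 1/2`, contrary to `hab`.
  obtain ⟨τ, hτ1, hτ2, hτ⟩ : ∃ τ, t₁ < τ ∧ τ < t₂ - T ∧ SOL.velocity γ τ 2 ≠ 0 := by
    by_contra! hcon
    obtain ⟨m, hm1, hm2⟩ := exists_between (show t₁ < t₂ - T by linarith)
    have hev : (fun s => SOL.velocity γ s 2) =ᶠ[nhds m] fun _ => 0 := by
      filter_upwards [Ioo_mem_nhds hm1 hm2] with s hs using hcon s hs.1 hs.2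
    have h0 := (hv m).unique ((hasDerivAt_const m (0 : ℝ)).congr_of_eventuallyEq hev)
    have h1 := hE m
    rw [hcon m hm1 hm2] at h1
    have h2 : Real.exp (2 * (γ m).coord 2) * Real.exp (-2 * (γ m).coord 2) = 1 := by
      rw [← Real.exp_add]; simp
    have h3 : a ^ 2 * Real.exp (2 * (γ m).coord 2) = 1 / 2 := by linarith
    have h4 : b ^ 2 * Real.exp (-2 * (γ m).coord 2) = 1 / 2 := by linarith
    have h5 : (|a| * |b|) ^ 2 = 1 / 4 := by
      rw [mul_pow, sq_abs, sq_abs]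
      linear_combination b ^ 2 * Real.exp (-2 * (γ m).coord 2) * h3 + 1 / 2 * h4 - a ^ 2 * b ^ 2 * h2
    have h6 : 0 ≤ |a| * |b| := by positivity
    nlinarith
  have l1 := hg.dist_le hunit hτ1.le
  have l2 := SOL.dist_lt_of_velocity_ne_zero hg hunit hT hz hvel hτ
    (show τ + T < t₂ by linarith)
  calc SOL.dist (γ t₁) (γ t₂) ≤ SOL.dist (γ t₁) (γ τ) + SOL.dist (γ τ) (γ t₂) :=
        SOL.dist_triangle _ _ _
    _ < ENNReal.ofReal (τ - t₁) + ENNReal.ofReal (t₂ - τ) :=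
        ENNReal.add_lt_add_of_le_of_lt (l1.trans_lt ENNReal.ofReal_lt_top).ne l1 l2
    _ = ENNReal.ofReal (t₂ - t₁) := by
        rw [← ENNReal.ofReal_add (by linarith) (by linarith)]
        congr 1; ring
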